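/- Let $M>0$. For $\varepsilon\in(0,1)$ with $\frac{M}{2\varepsilon}-1+\varepsilon>0$ (in particular for all small $\varepsilon>0$) let $\rho_\varepsilon$ be the mass density on $(-1,1)$ with $\rho_\varepsilon(x)=\varepsilon$ for $|x|<1-\varepsilon$ and $\rho_\varepsilon(x)=\frac{M}{2\varepsilon}-1+\varepsilon$ for $1-\varepsilon<|x|<1$. Consider the Neumann problem $$-u''=\lambda\rho_\varepsilon u\ \text{ in }(-1,1),\qquad u'(-1)=u'(1)=0,$$ where $u\not\equiv0$ is of class $C^1$ on $[-1,1]$ and the equation holds at all points of $(-1,1)$ other than $\pm(1-\varepsilon)$. Its eigenvalues are simple and form an infinite sequence $0=\lambda_0(\varepsilon)<\lambda_1(\varepsilon)<\lambda_2(\varepsilon)<\cdots$. Consider also the Steklov problem $$u''=0\ \text{ in }(-1,1),\qquad u'(\pm1)=\pm\lambda\tfrac{M}{2}\,u(\pm1).$$ Its only nonzero eigenvalue is $\lambda_1=2/M$. The first nonzero Neumann eigenvalue satisfies $$\lambda_1(\varepsilon)=\lambda_1+\tfrac23\left(\lambda_1+\lambda_1^2\right)\varepsilon+o(\varepsilon)\qquad\text{as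 }\varepsilon\to0^+,$$ and for every $l>1$ one has $\lambda_l(\varepsilon)\to+\infty$ as $\varepsilon\to0^+$. -/

import Mathlib

open Set Filter Topology Asymptotics

noncomputable section

/-- The mass density `ρ_ε` on `]-1,1[` with total mass `M`: it equals `ε` in the inner interval
and `M/(2ε) - 1 + ε` in the two boundary layers of width `ε`. (The values at the two points
`|x| = 1 - ε` play no role below.) -/
def massDensity (M ε x : ℝ) : ℝ :=
  if |x| ≤ 1 - ε then ε else M / (2 * ε) - 1 + ε

/-- `u` is an eigenfunction, for the eigenvalue `lam`, of the Neumann problem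
`-u'' = lam * ρ_ε * u` in `]-1,1[`, `u'(-1) = u'(1) = 0`.
As usual for a density with jumps, `u` is of class `C¹` on `[-1,1]` and the equation holds at all
points of `]-1,1[` other than the two points `±(1 - ε)` where the density jumps.
Only the restriction of `u` to `[-1,1]` matters. -/
structure IsNeumannEigenfunction (M ε lam : ℝ) (u : ℝ → ℝ) : Prop where
  contDiffOn : ContDiffOn ℝ 1 u (Icc (-1) 1)
  equation : ∀ x ∈ Ioo (-1 : ℝ) 1, |x| ≠ 1 - ε →
    HasDerivAt (deriv u) (-(lam * massDensity M ε x * u x)) x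
  neumann_left : HasDerivWithinAt u 0 (Icc (-1) 1) (-1)
  neumann_right : HasDerivWithinAt u 0 (Icc (-1) 1) 1
  nontrivial : ∃ x ∈ Icc (-1 : ℝ) 1, u x ≠ 0

/-- The set of eigenvalues of the Neumann problem with density `ρ_ε`. -/
def neumannSpectrum (M ε : ℝ) : Set ℝ :=
  {lam | ∃ u : ℝ → ℝ, IsNeumannEigenfunction M ε lam u}

/-- The eigenvalues `λ_0(ε) < λ_1(ε) < ⋯` of the Neumann problem in increasing order: the smallest
eigenvalue, then repeatedly the smallest eigenvalue greater than the previous one. -/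
def neumannEigenvalue (M ε : ℝ) : ℕ → ℝ
  | 0 => sInf (neumannSpectrum M ε)
  | l + 1 => sInf (neumannSpectrum M ε ∩ Ioi (neumannEigenvalue M ε l))

/-- `u` is an eigenfunction, for the eigenvalue `lam`, of the one-dimensional Steklov problem
`u'' = 0` in `]-1,1[`, `u'(±1) = ± lam * (M/2) * u(±1)`. -/
structure IsSteklovEigenfunction (M lam : ℝ) (u : ℝ → ℝ) : Prop where
  contDiffOn : ContDiffOn ℝ 1 u (Icc (-1) 1)
  equation : ∀ x ∈ Ioo (-1 : ℝ) 1, HasDerivAt (deriv u) 0 x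
  steklov_left : HasDerivWithinAt u (-(lam * (M / 2) * u (-1))) (Icc (-1) 1) (-1)
  steklov_right : HasDerivWithinAt u (lam * (M / 2) * u 1) (Icc (-1) 1) 1
  nontrivial : ∃ x ∈ Icc (-1 : ℝ) 1, u x ≠ 0

/-- The set of eigenvalues of the one-dimensional Steklov problem. -/
def steklovSpectrum (M : ℝ) : Set ℝ :=
  {lam | ∃ u : ℝ → ℝ, IsSteklovEigenfunction M lam u}

end

/-! The density is even and piecewise constant, so for `lam = k ^ 2` the solution with data `(1, 0)`
at `-1` is explicit: trigonometric arcs of frequency `b = k * √(layerDensity M ε)` in the layers and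
`a = k * √ε` inside. In polar form relative to the inner frequency, the phase on leaving the left
layer is `layerPhase r (b * ε)` with `r = b / a`; it then grows linearly, and its value at the
origin is `pruferPhase M ε k`. By symmetry the slope at `1` is proportional to `a * sin (2 *
pruferPhase)`. The phase is strictly increasing in `k`, from `0` to infinity, so the `n`-th
eigenvalue is exactly where it equals `n * π / 2` (`exists_neumann_frequencies`). Uniqueness for the
initial value problem shows that no eigenvalue is missed and gives simplicity.

For fixed `lam` the phase is eventually below `π` as `ε → 0`, so every eigenvalue of index at least
`2` exceeds `lam`: this is the divergence.

For index `1` the relevant quantity is the solution at the origin, `oddCharacteristic`, a positive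
multiple of the cosine of the phase. It extends to `ε = 0` with value `1 - lam * M / 2`, the Steklov
condition. Its right derivative at `0` along `lam = 2 / M + c * ε` changes sign exactly at the
claimed coefficient `c`; the sign decides on which side of `π / 2` the phase lies, hence traps the
eigenvalue between such lines. -/

/-- A function that is continuous on `[a, b]` and has nonpositive derivative inside, off two
points, is antitone. -/
theorem antitoneOn_Icc_of_hasDerivAt_off_pair {f f' : ℝ → ℝ} {a b p q : ℝ}
    (hap : a ≤ p) (hpq : p ≤ q) (hqb : q ≤ b) (hf : ContinuousOn f (Icc a b))
    (hd : ∀ x ∈ Ioo a b, x ≠ p → x ≠ q → HasDerivAt f (f' x) x)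
    (hn : ∀ x ∈ Ioo a b, x ≠ p → x ≠ q → f' x ≤ 0) : AntitoneOn f (Icc a b) := by
  have key : ∀ c d : ℝ, a ≤ c → d ≤ b → (∀ x ∈ Ioo c d, x ≠ p ∧ x ≠ q) →
      AntitoneOn f (Icc c d) := by
    intro c d hc hdb hx
    refine antitoneOn_of_hasDerivWithinAt_nonpos (f' := f') (convex_Icc c d)
      (hf.mono (Icc_subset_Icc hc hdb)) ?_ ?_
    · intro x hxi
      rw [interior_Icc] at hxi
      exact (hd x ⟨hc.trans_lt hxi.1, hxi.2.trans_le hdb⟩ (hx x hxi).1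
        (hx x hxi).2).hasDerivWithinAt
    · intro x hxi
      rw [interior_Icc] at hxi
      exact hn x ⟨hc.trans_lt hxi.1, hxi.2.trans_le hdb⟩ (hx x hxi).1 (hx x hxi).2
  have h1 := key a p le_rfl (hpq.trans hqb) fun x hx => ⟨hx.2.ne, (hx.2.trans_le hpq).ne⟩
  have h2 := key p q hap hqb fun x hx => ⟨hx.1.ne', hx.2.ne⟩
  have h3 := key q b (hap.trans hpq) le_rfl fun x hx => ⟨(hpq.trans_lt hx.1).ne', hx.1.ne'⟩
  have h12 := h1.union_right h2 (isGreatest_Icc hap) (isLeast_Icc hpq)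
  rw [Icc_union_Icc_eq_Icc hap hpq] at h12
  have h123 := h12.union_right h3 (isGreatest_Icc (hap.trans hpq)) (isLeast_Icc hqb)
  rwa [Icc_union_Icc_eq_Icc (hap.trans hpq) hqb] at h123

/-! ### Initial value problem: uniqueness and simplicity -/

/-- `u` solves `-u'' = lam * ρ_ε * u` in `]-1,1[`, with `d` the continuous extension of `u'`. -/
structure IsDensitySolution (M ε lam : ℝ) (u d : ℝ → ℝ) : Prop where
  continuousOn : ContinuousOn u (Icc (-1) 1)
  continuousOn_deriv : ContinuousOn d (Icc (-1) 1)
  hasDerivAt : ∀ x ∈ Ioo (-1 : ℝ) 1, HasDerivAt u (d x) x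
  equation : ∀ x ∈ Ioo (-1 : ℝ) 1, |x| ≠ 1 - ε →
    HasDerivAt d (-(lam * massDensity M ε x * u x)) x

theorem abs_ne_of_ne_of_ne_neg {x L : ℝ} (h1 : x ≠ -L) (h2 : x ≠ L) : |x| ≠ L := by
  intro h
  rcases abs_choice x with h' | h' <;> rw [h'] at h
  · exact h2 h
  · exact h1 (by linarith)

/-- The derivative of a function of class `C¹` on `[-1, 1]`, extended to the end points. -/
theorem ContDiffOn.exists_deriv_Icc {u : ℝ → ℝ} (hu : ContDiffOn ℝ 1 u (Icc (-1) 1)) :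
    ContinuousOn (derivWithin u (Icc (-1) 1)) (Icc (-1) 1) ∧
    (∀ x ∈ Ioo (-1 : ℝ) 1, HasDerivAt u (derivWithin u (Icc (-1) 1) x) x) ∧
    ∀ x ∈ Ioo (-1 : ℝ) 1, derivWithin u (Icc (-1) 1) =ᶠ[𝓝 x] deriv u := by
  have hU : UniqueDiffOn ℝ (Icc (-1 : ℝ) 1) := uniqueDiffOn_Icc (by norm_num)
  refine ⟨hu.continuousOn_derivWithin hU le_rfl, ?_, ?_⟩
  · intro x hx
    exact ((hu.differentiableOn one_ne_zero x (Ioo_subset_Icc_self hx)).hasDerivWithinAt).hasDerivAt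
      (Icc_mem_nhds hx.1 hx.2)
  · intro x hx
    filter_upwards [isOpen_Ioo.mem_nhds hx] with y hy
    exact derivWithin_of_mem_nhds (Icc_mem_nhds hy.1 hy.2)

namespace IsNeumannEigenfunction

variable {M ε lam : ℝ} {u : ℝ → ℝ}

/-- At `±1` the value of `deriv u` depends on `u` outside the interval; `derivWithin` supplies a
slope that is continuous up to the ends and carries the boundary conditions. -/
theorem exists_isDensitySolution (h : IsNeumannEigenfunction M ε lam u) :
    ∃ d, IsDensitySolution M ε lam u d ∧ d (-1) = 0 ∧ d 1 = 0 := by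
  obtain ⟨h1, h2, h3⟩ := h.contDiffOn.exists_deriv_Icc
  have hU : UniqueDiffOn ℝ (Icc (-1 : ℝ) 1) := uniqueDiffOn_Icc (by norm_num)
  refine ⟨derivWithin u (Icc (-1) 1), ⟨h.contDiffOn.continuousOn, h1, h2, ?_⟩, ?_, ?_⟩
  · intro x hx hx'
    exact (h.equation x hx hx').congr_of_eventuallyEq (h3 x hx)
  · exact h.neumann_left.derivWithin (hU _ (by norm_num))
  · exact h.neumann_right.derivWithin (hU _ (by norm_num))

end IsNeumannEigenfunction

namespace IsDensitySolution

variable {M ε lam : ℝ} {u v d e : ℝ → ℝ}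

theorem linear_comb (hu : IsDensitySolution M ε lam u d) (hv : IsDensitySolution M ε lam v e)
    (r s : ℝ) :
    IsDensitySolution M ε lam (fun x => r * u x + s * v x) (fun x => r * d x + s * e x) where
  continuousOn := (continuousOn_const.mul hu.continuousOn).add
    (continuousOn_const.mul hv.continuousOn)
  continuousOn_deriv := (continuousOn_const.mul hu.continuousOn_deriv).add
    (continuousOn_const.mul hv.continuousOn_deriv)
  hasDerivAt x hx := ((hu.hasDerivAt x hx).const_mul r).add ((hv.hasDerivAt x hx).const_mul s)
  equation x hx hx' := by
    refine (((hu.equation x hx hx').const_mul r).add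
      ((hv.equation x hx hx').const_mul s)).congr_deriv ?_
    ring

/-- Uniqueness for the initial value problem. -/
theorem eq_zero (hε : ε ∈ Ioo (0 : ℝ) 1) (hu : IsDensitySolution M ε lam u d)
    (h0 : u (-1) = 0) (h1 : d (-1) = 0) : ∀ x ∈ Icc (-1 : ℝ) 1, u x = 0 ∧ d x = 0 := by
  -- Gronwall argument: `u ^ 2 + d ^ 2` has derivative `2 * u * d * (1 - lam * ρ)`, and `C`
  -- dominates `|1 - lam * ρ|` for both values of the density.
  set C := |1 - lam * ε| + |1 - lam * (M / (2 * ε) - 1 + ε)| with hC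
  have hanti : AntitoneOn (fun x => (u x ^ 2 + d x ^ 2) * Real.exp (-C * x)) (Icc (-1) 1) := by
    refine antitoneOn_Icc_of_hasDerivAt_off_pair (p := -(1 - ε)) (q := 1 - ε)
      (f' := fun x => (2 * u x * d x * (1 - lam * massDensity M ε x) -
        C * (u x ^ 2 + d x ^ 2)) * Real.exp (-C * x))
      (by linarith [hε.1]) (by linarith [hε.2]) (by linarith [hε.1]) ?_ ?_ ?_
    · exact ((hu.continuousOn.pow 2).add (hu.continuousOn_deriv.pow 2)).mul (by fun_prop)
    · intro x hx hp hq
      have a1 := ((hu.hasDerivAt x hx).pow 2).add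
        ((hu.equation x hx (abs_ne_of_ne_of_ne_neg hp hq)).pow 2)
      have a2 : HasDerivAt (fun x => Real.exp (-C * x)) (Real.exp (-C * x) * (-C * 1)) x :=
        ((hasDerivAt_id x).const_mul (-C)).exp
      refine (a1.mul a2).congr_deriv ?_
      simp
      ring
    · intro x _ _ _
      refine mul_nonpos_of_nonpos_of_nonneg ?_ (Real.exp_pos _).le
      have hb : |1 - lam * massDensity M ε x| ≤ C := by
        unfold massDensity
        split_ifs
        · linarith [abs_nonneg (1 - lam * (M / (2 * ε) - 1 + ε))]
        · linarith [abs_nonneg (1 - lam * ε)]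
      have h2 : |2 * u x * d x| ≤ u x ^ 2 + d x ^ 2 := by
        rw [abs_le]
        constructor <;> nlinarith [sq_nonneg (u x + d x), sq_nonneg (u x - d x)]
      have h3 := le_abs_self (2 * u x * d x * (1 - lam * massDensity M ε x))
      rw [abs_mul] at h3
      have h4 := mul_le_mul h2 hb (abs_nonneg _) (by positivity)
      linarith
  intro x hx
  have h := hanti (left_mem_Icc.2 (by norm_num)) hx hx.1
  simp only [h0, h1] at h
  have hE := Real.exp_pos (-C * x)
  have h5 : u x ^ 2 + d x ^ 2 ≤ 0 := by
    by_contra! hc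
    have := mul_pos hc hE
    norm_num at h
    norm_num at this
    linarith
  constructor <;> nlinarith [sq_nonneg (u x), sq_nonneg (d x)]

/-- Two solutions with vanishing initial slope are proportional. -/
theorem eq_smul (hε : ε ∈ Ioo (0 : ℝ) 1) (hu : IsDensitySolution M ε lam u d)
    (hv : IsDensitySolution M ε lam v e) (hd : d (-1) = 0) (he : e (-1) = 0) :
    ∀ x ∈ Icc (-1 : ℝ) 1, u (-1) * v x = v (-1) * u x ∧ u (-1) * e x = v (-1) * d x := by
  intro x hx
  have := (hv.linear_comb hu (u (-1)) (-v (-1))).eq_zero hε (by ring) (by simp [hd, he]) x hx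
  exact ⟨by linarith [this.1], by linarith [this.2]⟩

theorem apply_neg_one_ne_zero (hε : ε ∈ Ioo (0 : ℝ) 1) (hu : IsDensitySolution M ε lam u d)
    (hd : d (-1) = 0) (hne : ∃ x ∈ Icc (-1 : ℝ) 1, u x ≠ 0) : u (-1) ≠ 0 := by
  intro h0
  obtain ⟨x, hx, hux⟩ := hne
  exact hux (hu.eq_zero hε h0 hd x hx).1

end IsDensitySolution

/-- Simplicity of the Neumann eigenvalues. -/
theorem IsNeumannEigenfunction.exists_eq_mul {M ε lam : ℝ} {u v : ℝ → ℝ}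
    (hε : ε ∈ Ioo (0 : ℝ) 1) (hu : IsNeumannEigenfunction M ε lam u)
    (hv : IsNeumannEigenfunction M ε lam v) : ∃ c : ℝ, ∀ x ∈ Icc (-1 : ℝ) 1, v x = c * u x := by
  obtain ⟨d, hd, hd0, -⟩ := hu.exists_isDensitySolution
  obtain ⟨e, he, he0, -⟩ := hv.exists_isDensitySolution
  have h0 := hd.apply_neg_one_ne_zero hε hd0 hu.nontrivial
  refine ⟨v (-1) / u (-1), fun x hx => ?_⟩
  have := (hd.eq_smul hε he hd0 he0 x hx).1
  field_simp
  linarith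

/-! ### Nonnegativity of the spectrum -/

theorem massDensity_pos {M ε : ℝ} (hε : 0 < ε) (hρ : 0 < M / (2 * ε) - 1 + ε) (x : ℝ) :
    0 < massDensity M ε x := by
  unfold massDensity
  split_ifs <;> assumption

/-- The Neumann eigenvalues are nonnegative. -/
theorem IsNeumannEigenfunction.nonneg {M ε lam : ℝ} {u : ℝ → ℝ} (hε : ε ∈ Ioo (0 : ℝ) 1)
    (hρ : 0 < M / (2 * ε) - 1 + ε) (hu : IsNeumannEigenfunction M ε lam u) : 0 ≤ lam := by
  by_contra! hlam
  obtain ⟨d, hd, hd0, hd1⟩ := hu.exists_isDensitySolution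
  have hder : ∀ x ∈ Ioo (-1 : ℝ) 1, |x| ≠ 1 - ε →
      HasDerivAt (fun x => -(u x * d x)) (-(d x ^ 2 - lam * massDensity M ε x * u x ^ 2)) x := by
    intro x hx hx'
    refine ((hd.hasDerivAt x hx).mul (hd.equation x hx hx')).neg.congr_deriv ?_
    ring
  have hsign : ∀ x, lam * massDensity M ε x < 0 := fun x =>
    mul_neg_of_neg_of_pos hlam (massDensity_pos hε.1 hρ x)
  have hanti : AntitoneOn (fun x => -(u x * d x)) (Icc (-1) 1) := by
    refine antitoneOn_Icc_of_hasDerivAt_off_pair (p := -(1 - ε)) (q := 1 - ε)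
      (by linarith [hε.1]) (by linarith [hε.2]) (by linarith [hε.1])
      (hd.continuousOn.mul hd.continuousOn_deriv).neg
      (fun x hx hp hq => hder x hx (abs_ne_of_ne_of_ne_neg hp hq)) ?_
    intro x _ _ _
    nlinarith [sq_nonneg (u x), sq_nonneg (d x), hsign x]
  -- A monotone function that vanishes at both ends vanishes throughout. Hence its derivative at
  -- `0`, a sum of terms of one sign, is zero, and `u ^ 2` is constant because its derivative is `2
  -- * u * d`.
  have hzero : ∀ x ∈ Icc (-1 : ℝ) 1, u x * d x = 0 := by
    intro x hx
    have h1 := hanti (left_mem_Icc.2 (by norm_num)) hx hx.1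
    have h2 := hanti hx (right_mem_Icc.2 (by norm_num)) hx.2
    simp only [hd0, hd1, mul_zero, neg_zero] at h1 h2
    linarith
  have hmem : (0 : ℝ) ∈ Ioo (-1 : ℝ) 1 := by norm_num
  have h0 : u 0 = 0 ∧ d 0 = 0 := by
    have h1 := hder 0 hmem (by rw [abs_zero]; linarith [hε.2])
    have h2 : HasDerivAt (fun x => -(u x * d x)) 0 0 := by
      refine (hasDerivAt_const (0 : ℝ) (0 : ℝ)).congr_of_eventuallyEq ?_
      filter_upwards [isOpen_Ioo.mem_nhds hmem] with x hx
      rw [hzero x (Ioo_subset_Icc_self hx), neg_zero]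
    have h3 := h1.unique h2
    have h4 := mul_nonneg (neg_nonneg.2 (hsign 0).le) (sq_nonneg (u 0))
    have hd2 : d 0 ^ 2 = 0 := by nlinarith [sq_nonneg (d 0)]
    have hu2 : lam * massDensity M ε 0 * u 0 ^ 2 = 0 := by linarith
    exact ⟨by simpa [(hsign 0).ne] using hu2, by simpa using hd2⟩
  have hconst : ∀ x ∈ Icc (-1 : ℝ) 1, u x ^ 2 = u (-1) ^ 2 := by
    refine constant_of_has_deriv_right_zero (hd.continuousOn.pow 2) ?_
    intro x hx
    have hx' : x ∈ Icc (-1 : ℝ) 1 := Ico_subset_Icc_self hx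
    have h1 : HasDerivWithinAt u (d x) (Ici x) x := by
      rcases hx.1.eq_or_lt with h | h
      · subst h
        rw [hd0]
        exact hu.neumann_left.mono_of_mem_nhdsWithin (Icc_mem_nhdsGE (by norm_num))
      · exact (hd.hasDerivAt x ⟨h, hx.2⟩).hasDerivWithinAt
    refine (h1.pow 2).congr_deriv ?_
    simp [mul_assoc, hzero x hx']
  obtain ⟨x, hx, hux⟩ := hu.nontrivial
  have h1 := hconst x hx
  rw [← hconst 0 (Ioo_subset_Icc_self hmem), h0.1] at h1
  exact hux (by simpa using h1)

/-! ### Gluing and trigonometric arcs -/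

/-- Gluing of two functions at `p`. -/
noncomputable def glueAt (p : ℝ) (f g : ℝ → ℝ) (x : ℝ) : ℝ := if x ≤ p then f x else g x

section glueAt

variable {p x f' : ℝ} {f g : ℝ → ℝ}

theorem glueAt_of_le (h : x ≤ p) : glueAt p f g x = f x := if_pos h

theorem glueAt_of_lt (h : p < x) : glueAt p f g x = g x := if_neg h.not_ge

theorem glueAt_eventuallyEq_left (h : x < p) : glueAt p f g =ᶠ[𝓝 x] f := by
  filter_upwards [Iio_mem_nhds h] with y hy using glueAt_of_le hy.le

theorem glueAt_eventuallyEq_right (h : p < x) : glueAt p f g =ᶠ[𝓝 x] g := by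
  filter_upwards [Ioi_mem_nhds h] with y hy using glueAt_of_lt hy

theorem HasDerivAt.glueAt_left (h : x < p) (hf : HasDerivAt f f' x) :
    HasDerivAt (glueAt p f g) f' x := hf.congr_of_eventuallyEq (glueAt_eventuallyEq_left h)

theorem HasDerivAt.glueAt_right (h : p < x) (hg : HasDerivAt g f' x) :
    HasDerivAt (glueAt p f g) f' x := hg.congr_of_eventuallyEq (glueAt_eventuallyEq_right h)

theorem Continuous.glueAt (hf : Continuous f) (hg : Continuous g) (h : f p = g p) :
    Continuous (glueAt p f g) :=
  hf.if_le hg continuous_id continuous_const (by rintro y rfl; exact h)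

theorem hasDerivAt_glueAt {df dg : ℝ → ℝ} (hf : ∀ x, HasDerivAt f (df x) x)
    (hg : ∀ x, HasDerivAt g (dg x) x) (h : f p = g p) (h' : df p = dg p) (x : ℝ) :
    HasDerivAt (glueAt p f g) (glueAt p df dg x) x := by
  rcases lt_trichotomy x p with hx | rfl | hx
  · rw [glueAt_of_le hx.le]
    exact (hf x).glueAt_left hx
  · rw [glueAt_of_le le_rfl]
    have h1 : HasDerivWithinAt (glueAt x f g) (df x) (Iic x) x :=
      (hf x).hasDerivWithinAt.congr (fun y hy => glueAt_of_le hy) (glueAt_of_le le_rfl)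
    have h2 : HasDerivWithinAt (glueAt x f g) (df x) (Ici x) x := by
      rw [h']
      refine (hg x).hasDerivWithinAt.congr (fun y hy => ?_) ((glueAt_of_le le_rfl).trans h)
      rcases (show x ≤ y from hy).eq_or_lt with rfl | hy
      · exact (glueAt_of_le le_rfl).trans h
      · exact glueAt_of_lt hy
    simpa [Iic_union_Ici] using h1.union h2
  · rw [glueAt_of_lt hx]
    exact (hg x).glueAt_right hx

end glueAt

/-- The solution of `u'' = -ω ^ 2 * u` with `u p = A` and `u' p = ω * B`. -/
noncomputable def harmonicArc (ω p A B x : ℝ) : ℝ :=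
  A * Real.cos (ω * (x - p)) + B * Real.sin (ω * (x - p))

theorem hasDerivAt_harmonicArc (ω p A B x : ℝ) :
    HasDerivAt (harmonicArc ω p A B) (ω * harmonicArc ω p B (-A) x) x := by
  have h : HasDerivAt (fun x => ω * (x - p)) ω x := by
    simpa using ((hasDerivAt_id x).sub_const p).const_mul ω
  refine ((h.cos.const_mul A).add (h.sin.const_mul B)).congr_deriv ?_
  unfold harmonicArc
  ring

theorem hasDerivAt_deriv_harmonicArc (ω p A B x : ℝ) :
    HasDerivAt (fun x => ω * harmonicArc ω p B (-A) x) (-(ω ^ 2 * harmonicArc ω p A B x)) x := by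
  refine ((hasDerivAt_harmonicArc ω p B (-A) x).const_mul ω).congr_deriv ?_
  unfold harmonicArc
  ring

theorem harmonicArc_self (ω p A B : ℝ) : harmonicArc ω p A B p = A := by
  simp [harmonicArc]

theorem continuous_harmonicArc (ω p A B : ℝ) : Continuous (harmonicArc ω p A B) := by
  unfold harmonicArc
  fun_prop

/-! ### Phase gained across a boundary layer -/

/-- The continuous branch of `arctan (r * tan t)` that vanishes at `0`. -/
noncomputable def layerPhase (r t : ℝ) : ℝ :=
  t + Real.arctan ((r - 1) * Real.sin t * Real.cos t / (Real.cos t ^ 2 + r * Real.sin t ^ 2))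

/-- The amplitude that goes with `layerPhase`. -/
noncomputable def layerAmplitude (r t : ℝ) : ℝ :=
  (Real.cos t ^ 2 + r * Real.sin t ^ 2) *
    √(1 + ((r - 1) * Real.sin t * Real.cos t / (Real.cos t ^ 2 + r * Real.sin t ^ 2)) ^ 2)

section layerPhase

variable {r : ℝ}

theorem cos_sq_add_mul_sin_sq_pos (hr : 0 < r) (t : ℝ) :
    0 < Real.cos t ^ 2 + r * Real.sin t ^ 2 := by
  have h := Real.sin_sq_add_cos_sq t
  rcases (sq_nonneg (Real.sin t)).eq_or_lt with h0 | h0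
  · rw [← h0] at h ⊢
    linarith
  · have := mul_pos hr h0
    linarith [sq_nonneg (Real.cos t)]

theorem layerAmplitude_pos (hr : 0 < r) (t : ℝ) : 0 < layerAmplitude r t :=
  mul_pos (cos_sq_add_mul_sin_sq_pos hr t) (Real.sqrt_pos.2 (by positivity))

/-- With the sine companion below, this gives polar coordinates of `(cos t, r * sin t)`. The
arctangent in `layerPhase` is the angle from `(cos t, sin t)` to that point: their inner product is
the denominator, which is positive, and the cross product is the numerator. -/
theorem layerAmplitude_mul_cos (hr : 0 < r) (t : ℝ) :
    layerAmplitude r t * Real.cos (layerPhase r t) = Real.cos t := by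
  have hD := (cos_sq_add_mul_sin_sq_pos hr t).ne'
  unfold layerAmplitude layerPhase
  rw [Real.cos_add, Real.cos_arctan, Real.sin_arctan]
  set x := (r - 1) * Real.sin t * Real.cos t / (Real.cos t ^ 2 + r * Real.sin t ^ 2) with hx
  have hxD : (Real.cos t ^ 2 + r * Real.sin t ^ 2) * x = (r - 1) * Real.sin t * Real.cos t := by
    rw [hx]; field_simp
  have hs : √(1 + x ^ 2) ≠ 0 := (Real.sqrt_pos.2 (by positivity)).ne'
  have h := Real.sin_sq_add_cos_sq t
  calc _ = (Real.cos t ^ 2 + r * Real.sin t ^ 2) * Real.cos t -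
        Real.sin t * ((Real.cos t ^ 2 + r * Real.sin t ^ 2) * x) := by field_simp
    _ = Real.cos t * (Real.sin t ^ 2 + Real.cos t ^ 2) := by rw [hxD]; ring
    _ = _ := by rw [h, mul_one]

theorem layerAmplitude_mul_sin (hr : 0 < r) (t : ℝ) :
    layerAmplitude r t * Real.sin (layerPhase r t) = r * Real.sin t := by
  have hD := (cos_sq_add_mul_sin_sq_pos hr t).ne'
  unfold layerAmplitude layerPhase
  rw [Real.sin_add, Real.cos_arctan, Real.sin_arctan]
  set x := (r - 1) * Real.sin t * Real.cos t / (Real.cos t ^ 2 + r * Real.sin t ^ 2) with hx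
  have hxD : (Real.cos t ^ 2 + r * Real.sin t ^ 2) * x = (r - 1) * Real.sin t * Real.cos t := by
    rw [hx]; field_simp
  have hs : √(1 + x ^ 2) ≠ 0 := (Real.sqrt_pos.2 (by positivity)).ne'
  have h := Real.sin_sq_add_cos_sq t
  calc _ = (Real.cos t ^ 2 + r * Real.sin t ^ 2) * Real.sin t +
        Real.cos t * ((Real.cos t ^ 2 + r * Real.sin t ^ 2) * x) := by field_simp
    _ = r * Real.sin t * (Real.sin t ^ 2 + Real.cos t ^ 2) := by rw [hxD]; ring
    _ = _ := by rw [h, mul_one]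

theorem hasDerivAt_layerPhase (hr : 0 < r) (t : ℝ) :
    HasDerivAt (layerPhase r) (r / (Real.cos t ^ 2 + r ^ 2 * Real.sin t ^ 2)) t := by
  have hD := (cos_sq_add_mul_sin_sq_pos hr t).ne'
  have hE := (cos_sq_add_mul_sin_sq_pos (sq_pos_of_pos hr) t).ne'
  have hN : HasDerivAt (fun t => (r - 1) * Real.sin t * Real.cos t)
      ((r - 1) * (Real.cos t ^ 2 - Real.sin t ^ 2)) t := by
    refine (((Real.hasDerivAt_sin t).const_mul (r - 1)).mul (Real.hasDerivAt_cos t)).congr_deriv ?_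
    ring
  have hD' : HasDerivAt (fun t => Real.cos t ^ 2 + r * Real.sin t ^ 2)
      (2 * (r - 1) * Real.sin t * Real.cos t) t := by
    refine (((Real.hasDerivAt_cos t).pow 2).add
      (((Real.hasDerivAt_sin t).pow 2).const_mul r)).congr_deriv ?_
    simp
    ring
  refine ((hasDerivAt_id t).add (hN.div hD' hD).arctan).congr_deriv ?_
  have h := Real.sin_sq_add_cos_sq t
  have hEq : (Real.cos t ^ 2 + r * Real.sin t ^ 2) ^ 2 +
      ((r - 1) * Real.sin t * Real.cos t) ^ 2 = Real.cos t ^ 2 + r ^ 2 * Real.sin t ^ 2 := by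
    calc _ = (Real.cos t ^ 2 + r ^ 2 * Real.sin t ^ 2) *
          (Real.sin t ^ 2 + Real.cos t ^ 2) := by ring
      _ = _ := by rw [h, mul_one]
  have hx : 1 + ((r - 1) * Real.sin t * Real.cos t /
      (Real.cos t ^ 2 + r * Real.sin t ^ 2)) ^ 2 =
      (Real.cos t ^ 2 + r ^ 2 * Real.sin t ^ 2) / (Real.cos t ^ 2 + r * Real.sin t ^ 2) ^ 2 := by
    rw [← hEq]
    field_simp
  simp only [Pi.div_apply, hx]
  have hnum : (r - 1) * (Real.cos t ^ 2 - Real.sin t ^ 2) *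
      (Real.cos t ^ 2 + r * Real.sin t ^ 2) - (r - 1) * Real.sin t * Real.cos t *
      (2 * (r - 1) * Real.sin t * Real.cos t) =
      (r - 1) * (Real.cos t ^ 2 - r * Real.sin t ^ 2) := by
    calc _ = (r - 1) * (Real.cos t ^ 2 - r * Real.sin t ^ 2) *
          (Real.sin t ^ 2 + Real.cos t ^ 2) := by ring
      _ = _ := by rw [h, mul_one]
  rw [hnum]
  field_simp
  linear_combination r * h

theorem strictMono_layerPhase (hr : 0 < r) : StrictMono (layerPhase r) :=
  strictMono_of_hasDerivAt_pos (hasDerivAt_layerPhase hr) fun t =>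
    div_pos hr (cos_sq_add_mul_sin_sq_pos (sq_pos_of_pos hr) t)

theorem continuous_layerPhase (hr : 0 < r) : Continuous (layerPhase r) :=
  continuous_iff_continuousAt.2 fun t => (hasDerivAt_layerPhase hr t).continuousAt

@[simp] theorem layerPhase_zero : layerPhase r 0 = 0 := by simp [layerPhase]

-- This fixed point does not depend on `r`, so it bounds the layer phase uniformly even though `r`
-- blows up as `ε → 0`.
@[simp] theorem layerPhase_pi_div_two : layerPhase r (Real.pi / 2) = Real.pi / 2 := by
  simp [layerPhase]

theorem sub_lt_layerPhase (r t : ℝ) : t - Real.pi / 2 < layerPhase r t := by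
  unfold layerPhase
  linarith [Real.neg_pi_div_two_lt_arctan
    ((r - 1) * Real.sin t * Real.cos t / (Real.cos t ^ 2 + r * Real.sin t ^ 2))]

end layerPhase

/-! ### The Prüfer phase as a function of the frequency -/

/-- The mass density in the boundary layers. -/
noncomputable def layerDensity (M ε : ℝ) : ℝ := M / (2 * ε) - 1 + ε

/-- The Prüfer phase at the origin of the solution for the eigenvalue `k ^ 2`; the Neumann
eigenvalues correspond to the values in `(π / 2) * ℕ`. -/
noncomputable def pruferPhase (M ε k : ℝ) : ℝ :=
  layerPhase (√(layerDensity M ε) / √ε) (k * √(layerDensity M ε) * ε) + k * √ε * (1 - ε)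

section pruferPhase

variable {M ε : ℝ}

theorem strictMono_pruferPhase (hε : ε ∈ Ioo (0 : ℝ) 1) (hρ : 0 < layerDensity M ε) :
    StrictMono (pruferPhase M ε) := by
  have h1 := Real.sqrt_pos.2 hε.1
  have h2 := Real.sqrt_pos.2 hρ
  have hL : 0 < 1 - ε := sub_pos.2 hε.2
  refine ((strictMono_layerPhase (div_pos h2 h1)).comp fun x y hxy => ?_).add fun x y hxy => ?_
  · exact mul_lt_mul_of_pos_right (mul_lt_mul_of_pos_right hxy h2) hε.1
  · exact mul_lt_mul_of_pos_right (mul_lt_mul_of_pos_right hxy h1) hL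

theorem continuous_pruferPhase (hε : 0 < ε) (hρ : 0 < layerDensity M ε) :
    Continuous (pruferPhase M ε) := by
  have := continuous_layerPhase (div_pos (Real.sqrt_pos.2 hρ) (Real.sqrt_pos.2 hε))
  unfold pruferPhase
  fun_prop

@[simp] theorem pruferPhase_zero : pruferPhase M ε 0 = 0 := by simp [pruferPhase]

theorem tendsto_pruferPhase_atTop (hε : ε ∈ Ioo (0 : ℝ) 1) (hρ : 0 < layerDensity M ε) :
    Tendsto (pruferPhase M ε) atTop atTop := by
  have h1 := Real.sqrt_pos.2 hε.1
  have h2 := Real.sqrt_pos.2 hρ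
  have hL : 0 < 1 - ε := sub_pos.2 hε.2
  have hlin : Tendsto (fun k : ℝ => k * (√(layerDensity M ε) * ε + √ε * (1 - ε)) - Real.pi / 2)
      atTop atTop :=
    tendsto_atTop_add_const_right _ _ (tendsto_id.atTop_mul_const
      (add_pos (mul_pos h2 hε.1) (mul_pos h1 hL)))
  refine tendsto_atTop_mono (fun k => ?_) hlin
  unfold pruferPhase
  linarith [sub_lt_layerPhase (√(layerDensity M ε) / √ε) (k * √(layerDensity M ε) * ε)]

theorem exists_pruferPhase_eq (hε : ε ∈ Ioo (0 : ℝ) 1) (hρ : 0 < layerDensity M ε) {y : ℝ}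
    (hy : 0 ≤ y) : ∃ k, 0 ≤ k ∧ pruferPhase M ε k = y := by
  obtain ⟨K, hK, hK0⟩ := (((tendsto_pruferPhase_atTop hε hρ).eventually_ge_atTop y).and
    (eventually_ge_atTop 0)).exists
  obtain ⟨k, hk, hky⟩ := intermediate_value_Icc hK0 (continuous_pruferPhase hε.1 hρ).continuousOn
    (by rw [pruferPhase_zero]; exact ⟨hy, hK⟩ : y ∈ Icc _ _)
  exact ⟨k, hk.1, hky⟩

end pruferPhase

/-! ### The explicit solution of the initial value problem -/

/-- Value at `1 - ε` of the solution with data `(1, 0)` at `-1`. -/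
noncomputable def shootingValue (r t s : ℝ) : ℝ :=
  Real.cos t * Real.cos s - r * Real.sin t * Real.sin s

/-- Slope at `1 - ε`, divided by the inner frequency, of the solution with data `(1, 0)` at `-1`. -/
noncomputable def shootingSlope (r t s : ℝ) : ℝ :=
  -(r * Real.sin t * Real.cos s + Real.cos t * Real.sin s)

/-- With inner frequency `a` and layer frequency `b = r * a`, the solution with data `(1, 0)` at
`-1`. -/
noncomputable def shootingSolution (r a b ε : ℝ) : ℝ → ℝ :=
  glueAt (-(1 - ε)) (harmonicArc b (-1) 1 0)
    (glueAt (1 - ε) (harmonicArc a (-(1 - ε)) (Real.cos (b * ε)) (-(r * Real.sin (b * ε))))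
      (harmonicArc b (1 - ε) (shootingValue r (b * ε) (2 * (a * (1 - ε))))
        (shootingSlope r (b * ε) (2 * (a * (1 - ε))) / r)))

/-- The derivative of `shootingSolution`. -/
noncomputable def shootingDeriv (r a b ε : ℝ) : ℝ → ℝ :=
  glueAt (-(1 - ε)) (fun x => b * harmonicArc b (-1) 0 (-1) x)
    (glueAt (1 - ε)
      (fun x => a * harmonicArc a (-(1 - ε)) (-(r * Real.sin (b * ε))) (-Real.cos (b * ε)) x)
      (fun x => b * harmonicArc b (1 - ε) (shootingSlope r (b * ε) (2 * (a * (1 - ε))) / r)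
        (-shootingValue r (b * ε) (2 * (a * (1 - ε)))) x))

section shooting

variable {r a b ε : ℝ}

/-- `shootingSlope` is measured in units of `a`, and dividing by `r` converts it to units of `b`.
Assuming `b = r * a` instead of defining `r` as a quotient keeps the case `a = b = 0` of zero
frequency. -/
theorem shooting_match_right (hr : 0 < r) (hb : b = r * a) :
    harmonicArc a (-(1 - ε)) (Real.cos (b * ε)) (-(r * Real.sin (b * ε))) (1 - ε) =
      harmonicArc b (1 - ε) (shootingValue r (b * ε) (2 * (a * (1 - ε))))
        (shootingSlope r (b * ε) (2 * (a * (1 - ε))) / r) (1 - ε) ∧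
    a * harmonicArc a (-(1 - ε)) (-(r * Real.sin (b * ε))) (-Real.cos (b * ε)) (1 - ε) =
      b * harmonicArc b (1 - ε) (shootingSlope r (b * ε) (2 * (a * (1 - ε))) / r)
        (-shootingValue r (b * ε) (2 * (a * (1 - ε)))) (1 - ε) := by
  have hs : a * (1 - ε - -(1 - ε)) = 2 * (a * (1 - ε)) := by ring
  rw [harmonicArc_self, harmonicArc_self]
  unfold harmonicArc
  rw [hs]
  constructor
  · unfold shootingValue
    ring
  · have : b / r = a := by rw [hb]; field_simp
    rw [mul_div_left_comm, this]
    unfold shootingSlope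
    ring

/-- The branches `f` and `g` are free because `-(1 - ε)` lies to the left of the second gluing
point. -/
theorem shooting_match_left (hε : ε ∈ Ioo (0 : ℝ) 1) (hb : b = r * a) (f g : ℝ → ℝ) :
    harmonicArc b (-1) 1 0 (-(1 - ε)) = glueAt (1 - ε)
      (harmonicArc a (-(1 - ε)) (Real.cos (b * ε)) (-(r * Real.sin (b * ε)))) f (-(1 - ε)) ∧
    b * harmonicArc b (-1) 0 (-1) (-(1 - ε)) = glueAt (1 - ε)
      (fun x => a * harmonicArc a (-(1 - ε)) (-(r * Real.sin (b * ε))) (-Real.cos (b * ε)) x) g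
        (-(1 - ε)) := by
  have hs : b * (-(1 - ε) - -1) = b * ε := by ring
  rw [glueAt_of_le (by linarith [hε.2]), glueAt_of_le (by linarith [hε.2]), harmonicArc_self,
    harmonicArc_self]
  unfold harmonicArc
  rw [hs]
  constructor
  · ring
  · linear_combination -Real.sin (b * ε) * hb

theorem hasDerivAt_shootingSolution (hε : ε ∈ Ioo (0 : ℝ) 1) (hr : 0 < r) (hb : b = r * a)
    (x : ℝ) : HasDerivAt (shootingSolution r a b ε) (shootingDeriv r a b ε x) x := by
  have hR := shooting_match_right (ε := ε) hr hb
  have hL := shooting_match_left hε hb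
  refine hasDerivAt_glueAt (fun x => ?_) (hasDerivAt_glueAt (fun x => ?_) (fun x => ?_) hR.1 hR.2)
    (hL _ (fun _ => 0)).1 (hL (fun _ => 0) _).2 x
  · simpa using hasDerivAt_harmonicArc b (-1) 1 0 x
  · exact hasDerivAt_harmonicArc _ _ _ _ _
  · exact hasDerivAt_harmonicArc _ _ _ _ _

theorem continuous_shootingDeriv (hε : ε ∈ Ioo (0 : ℝ) 1) (hr : 0 < r) (hb : b = r * a) :
    Continuous (shootingDeriv r a b ε) := by
  have c := continuous_harmonicArc
  exact (continuous_const.mul (c _ _ _ _)).glueAt ((continuous_const.mul (c _ _ _ _)).glueAt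
    (continuous_const.mul (c _ _ _ _)) (shooting_match_right hr hb).2)
    (shooting_match_left hε hb (fun _ => 0) _).2

theorem hasDerivAt_shootingDeriv {M : ℝ} (hε : ε ∈ Ioo (0 : ℝ) 1) {x lam : ℝ}
    (ha : a ^ 2 = lam * ε) (hb : b ^ 2 = lam * layerDensity M ε) (hx : |x| ≠ 1 - ε) :
    HasDerivAt (shootingDeriv r a b ε)
      (-(lam * massDensity M ε x * shootingSolution r a b ε x)) x := by
  have hL : 0 < 1 - ε := sub_pos.2 hε.2
  unfold massDensity
  rw [← layerDensity]
  rcases hx.lt_or_gt with h | h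
  · obtain ⟨h1, h2⟩ := abs_lt.1 h
    rw [if_pos h.le, shootingSolution, glueAt_of_lt h1, glueAt_of_le h2.le, ← ha]
    refine HasDerivAt.glueAt_right h1 (HasDerivAt.glueAt_left h2 ?_)
    simpa using hasDerivAt_deriv_harmonicArc a (-(1 - ε)) (Real.cos (b * ε))
      (-(r * Real.sin (b * ε))) x
  · rw [if_neg h.not_ge, ← hb]
    rcases lt_abs.1 h with h | h
    · rw [shootingSolution, glueAt_of_lt (by linarith), glueAt_of_lt h]
      exact HasDerivAt.glueAt_right (by linarith) (HasDerivAt.glueAt_right h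
        (hasDerivAt_deriv_harmonicArc _ _ _ _ _))
    · rw [shootingSolution, glueAt_of_le (by linarith)]
      exact HasDerivAt.glueAt_left (by linarith) (hasDerivAt_deriv_harmonicArc _ _ _ _ _)

theorem shootingSolution_neg_one (hε : 0 < ε) : shootingSolution r a b ε (-1) = 1 := by
  rw [shootingSolution, glueAt_of_le (by linarith), harmonicArc_self]

theorem shootingDeriv_neg_one (hε : 0 < ε) : shootingDeriv r a b ε (-1) = 0 := by
  rw [shootingDeriv, glueAt_of_le (by linarith), harmonicArc_self, mul_zero]

/-- With `g`, `Q` the layer phase and amplitude and `s = 2 * a * (1 - ε)`, the solution enters the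
right layer with value `Q * cos (g + s)` and scaled slope `-Q * sin (g + s)`. Crossing that layer
contributes `g` and `Q` once more, by the addition formula. -/
theorem shootingDeriv_one (hε : ε ∈ Ioo (0 : ℝ) 1) (hr : 0 < r) (hb : b = r * a) :
    shootingDeriv r a b ε 1 = -(a * layerAmplitude r (b * ε) ^ 2 *
      Real.sin (2 * (layerPhase r (b * ε) + a * (1 - ε)))) := by
  have h1 := layerAmplitude_mul_cos hr (b * ε)
  have h2 := layerAmplitude_mul_sin hr (b * ε)
  rw [shootingDeriv, glueAt_of_lt (by linarith [hε.2]), glueAt_of_lt (by linarith [hε.1])]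
  unfold harmonicArc
  have hs : b * (1 - (1 - ε)) = b * ε := by ring
  have hba : b / r = a := by rw [hb]; field_simp
  rw [hs, mul_add 2, Real.sin_add, Real.sin_two_mul, Real.cos_two_mul' (layerPhase r (b * ε))]
  unfold shootingSlope shootingValue
  set t := b * ε
  set s := 2 * (a * (1 - ε))
  set g := layerPhase r t
  set Q := layerAmplitude r t
  calc _ = b / r * (-(r * Real.sin t * Real.cos s + Real.cos t * Real.sin s) * Real.cos t -
        (Real.cos t * Real.cos s - r * Real.sin t * Real.sin s) * (r * Real.sin t)) := by
        field_simp
        ring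
    _ = _ := by
        rw [hba, ← h1, ← h2]
        ring

end shooting

/-! ### The Neumann spectrum in terms of the phase -/

section spectrum

variable {M ε k : ℝ}

theorem layer_frequency (hε : 0 < ε) :
    k * √(layerDensity M ε) = √(layerDensity M ε) / √ε * (k * √ε) := by
  have := (Real.sqrt_pos.2 hε).ne'
  field_simp

theorem isDensitySolution_shootingSolution (hε : ε ∈ Ioo (0 : ℝ) 1)
    (hρ : 0 < layerDensity M ε) :
    IsDensitySolution M ε (k ^ 2)
      (shootingSolution (√(layerDensity M ε) / √ε) (k * √ε) (k * √(layerDensity M ε)) ε)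
      (shootingDeriv (√(layerDensity M ε) / √ε) (k * √ε) (k * √(layerDensity M ε)) ε) := by
  have hr : 0 < √(layerDensity M ε) / √ε := div_pos (Real.sqrt_pos.2 hρ) (Real.sqrt_pos.2 hε.1)
  have hd := hasDerivAt_shootingSolution hε hr (layer_frequency (M := M) (k := k) hε.1)
  exact ⟨fun x _ => (hd x).continuousAt.continuousWithinAt,
    (continuous_shootingDeriv hε hr (layer_frequency hε.1)).continuousOn,
    fun x _ => hd x, fun x _ hx => hasDerivAt_shootingDeriv hε
      (by rw [mul_pow, Real.sq_sqrt hε.1.le]) (by rw [mul_pow, Real.sq_sqrt hρ.le]) hx⟩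

theorem shootingDeriv_one_eq_zero_iff (hε : ε ∈ Ioo (0 : ℝ) 1) (hρ : 0 < layerDensity M ε)
    (hk : 0 ≤ k) :
    shootingDeriv (√(layerDensity M ε) / √ε) (k * √ε) (k * √(layerDensity M ε)) ε 1 = 0 ↔
      ∃ n : ℕ, pruferPhase M ε k = n * (Real.pi / 2) := by
  have hr : 0 < √(layerDensity M ε) / √ε := div_pos (Real.sqrt_pos.2 hρ) (Real.sqrt_pos.2 hε.1)
  rw [shootingDeriv_one hε hr (layer_frequency hε.1), ← pruferPhase, neg_eq_zero, mul_eq_zero,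
    mul_eq_zero]
  simp only [pow_eq_zero_iff two_ne_zero, (layerAmplitude_pos hr _).ne', or_false,
    mul_eq_zero, (Real.sqrt_pos.2 hε.1).ne']
  constructor
  · rintro (rfl | h)
    -- At `k = 0` the slope vanishes through the factor `a`, in agreement with `n = 0`: the constant
    -- eigenfunction.
    · exact ⟨0, by simp⟩
    · obtain ⟨n, hn⟩ := Real.sin_eq_zero_iff.1 h
      have h0 : 0 ≤ pruferPhase M ε k := by
        have := (strictMono_pruferPhase hε hρ).monotone hk
        rwa [pruferPhase_zero] at this
      have hn0 : 0 ≤ n := by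
        by_contra! hneg
        have : (n : ℝ) < 0 := by exact_mod_cast hneg
        nlinarith [Real.pi_pos]
      lift n to ℕ using hn0
      refine ⟨n, ?_⟩
      push_cast at hn
      linarith
  · rintro ⟨n, hn⟩
    right
    rw [hn, ← Real.sin_nat_mul_pi n]
    ring_nf

theorem mem_neumannSpectrum_iff (hε : ε ∈ Ioo (0 : ℝ) 1) (hρ : 0 < layerDensity M ε) {lam : ℝ} :
    lam ∈ neumannSpectrum M ε ↔
      ∃ k, 0 ≤ k ∧ lam = k ^ 2 ∧ ∃ n : ℕ, pruferPhase M ε k = n * (Real.pi / 2) := by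
  have hr : 0 < √(layerDensity M ε) / √ε := div_pos (Real.sqrt_pos.2 hρ) (Real.sqrt_pos.2 hε.1)
  constructor
  · rintro ⟨u, hu⟩
    have hlam := hu.nonneg hε hρ
    refine ⟨√lam, Real.sqrt_nonneg _, (Real.sq_sqrt hlam).symm, ?_⟩
    rw [← shootingDeriv_one_eq_zero_iff hε hρ (Real.sqrt_nonneg _)]
    obtain ⟨d, hd, hd0, hd1⟩ := hu.exists_isDensitySolution
    have h0 := hd.apply_neg_one_ne_zero hε hd0 hu.nontrivial
    have hs := isDensitySolution_shootingSolution (k := √lam) hε hρ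
    rw [Real.sq_sqrt hlam] at hs
    -- The eigenfunction is proportional to the shooting solution, which therefore also has zero
    -- slope at `1`.
    have h := (hd.eq_smul hε hs hd0 (shootingDeriv_neg_one hε.1) 1 (by norm_num)).2
    rw [hd1, mul_zero] at h
    exact (mul_eq_zero.1 h).resolve_left h0
  · rintro ⟨k, hk, rfl, hn⟩
    rw [← shootingDeriv_one_eq_zero_iff hε hρ hk] at hn
    have hd := hasDerivAt_shootingSolution hε hr (layer_frequency (M := M) (k := k) hε.1)
    have hderiv := funext fun x => (hd x).deriv
    refine ⟨shootingSolution (√(layerDensity M ε) / √ε) (k * √ε) (k * √(layerDensity M ε)) ε,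
      ContDiff.contDiffOn ?_, fun x hx hx' => ?_, ?_, ?_,
      -1, by norm_num, (shootingSolution_neg_one hε.1).trans_ne one_ne_zero⟩
    · rw [contDiff_one_iff_deriv, hderiv]
      exact ⟨fun x => (hd x).differentiableAt,
        continuous_shootingDeriv hε hr (layer_frequency hε.1)⟩
    · rw [hderiv]
      exact (isDensitySolution_shootingSolution hε hρ).equation x hx hx'
    · exact (shootingDeriv_neg_one (r := √(layerDensity M ε) / √ε) (a := k * √ε)
        (b := k * √(layerDensity M ε)) hε.1) ▸ (hd (-1)).hasDerivWithinAt
    · exact hn ▸ (hd 1).hasDerivWithinAt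

/-- The Neumann eigenvalues, as squares of the frequencies at which the Prüfer phase is a multiple
of `π / 2`. -/
theorem exists_neumann_frequencies (hε : ε ∈ Ioo (0 : ℝ) 1) (hρ : 0 < layerDensity M ε) :
    ∃ κ : ℕ → ℝ, (∀ n, 0 ≤ κ n) ∧ (∀ n, pruferPhase M ε (κ n) = n * (Real.pi / 2)) ∧
      StrictMono (fun n => κ n ^ 2) ∧ range (fun n => κ n ^ 2) = neumannSpectrum M ε := by
  have h : ∀ n : ℕ, ∃ k, 0 ≤ k ∧ pruferPhase M ε k = n * (Real.pi / 2) := fun n =>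
    exists_pruferPhase_eq hε hρ (by positivity)
  choose κ h0 hκ using h
  have hmono := strictMono_pruferPhase hε hρ
  refine ⟨κ, h0, hκ, strictMono_nat_of_lt_succ fun n => ?_, ?_⟩
  · refine pow_lt_pow_left₀ (hmono.lt_iff_lt.1 ?_) (h0 n) two_ne_zero
    rw [hκ, hκ]
    push_cast
    linarith [Real.pi_pos]
  · ext lam
    rw [mem_neumannSpectrum_iff hε hρ]
    constructor
    · rintro ⟨n, rfl⟩
      exact ⟨κ n, h0 n, rfl, n, hκ n⟩
    · rintro ⟨k, -, rfl, n, hn⟩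
      exact ⟨n, by rw [hmono.injective (hn.trans (hκ n).symm)]⟩

/-- For a set enumerated increasingly by the naturals, every infimum in the recursion is attained,
at the next term. -/
theorem neumannEigenvalue_eq_of_range_eq {f : ℕ → ℝ} (hf : StrictMono f)
    (hr : range f = neumannSpectrum M ε) : neumannEigenvalue M ε = f := by
  funext n
  induction n with
  | zero =>
    rw [neumannEigenvalue, ← hr]
    refine IsLeast.csInf_eq ⟨mem_range_self 0, ?_⟩
    rintro _ ⟨m, rfl⟩
    exact hf.monotone (Nat.zero_le m)
  | succ n ih =>
    rw [neumannEigenvalue, ih, ← hr]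
    refine IsLeast.csInf_eq ⟨⟨mem_range_self _, hf n.lt_succ_self⟩, ?_⟩
    rintro _ ⟨⟨m, rfl⟩, hm⟩
    exact hf.monotone (Nat.succ_le_of_lt (hf.lt_iff_lt.1 hm))

theorem strictMono_neumannEigenvalue (hε : ε ∈ Ioo (0 : ℝ) 1) (hρ : 0 < layerDensity M ε) :
    StrictMono (neumannEigenvalue M ε) ∧ range (neumannEigenvalue M ε) = neumannSpectrum M ε := by
  obtain ⟨κ, -, -, hm, hr⟩ := exists_neumann_frequencies hε hρ
  rw [neumannEigenvalue_eq_of_range_eq hm hr]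
  exact ⟨hm, hr⟩

theorem pruferPhase_sqrt_neumannEigenvalue (hε : ε ∈ Ioo (0 : ℝ) 1)
    (hρ : 0 < layerDensity M ε) (n : ℕ) :
    0 ≤ neumannEigenvalue M ε n ∧
      pruferPhase M ε √(neumannEigenvalue M ε n) = n * (Real.pi / 2) := by
  obtain ⟨κ, h0, hκ, hm, hr⟩ := exists_neumann_frequencies hε hρ
  rw [neumannEigenvalue_eq_of_range_eq hm hr]
  exact ⟨sq_nonneg _, by rw [Real.sqrt_sq (h0 n), hκ]⟩

theorem lt_neumannEigenvalue_of_pruferPhase_lt (hε : ε ∈ Ioo (0 : ℝ) 1)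
    (hρ : 0 < layerDensity M ε) {lam : ℝ} {n : ℕ}
    (h : pruferPhase M ε √lam < n * (Real.pi / 2)) : lam < neumannEigenvalue M ε n := by
  rw [← (pruferPhase_sqrt_neumannEigenvalue hε hρ n).2,
    (strictMono_pruferPhase hε hρ).lt_iff_lt] at h
  -- `Real.sqrt` is monotone on all of `ℝ`, so `lam` needs no sign condition.
  exact lt_of_not_ge fun hle => h.not_ge (Real.sqrt_le_sqrt hle)

theorem neumannEigenvalue_lt_of_lt_pruferPhase (hε : ε ∈ Ioo (0 : ℝ) 1)
    (hρ : 0 < layerDensity M ε) {lam : ℝ} {n : ℕ}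
    (h : n * (Real.pi / 2) < pruferPhase M ε √lam) : neumannEigenvalue M ε n < lam := by
  rw [← (pruferPhase_sqrt_neumannEigenvalue hε hρ n).2,
    (strictMono_pruferPhase hε hρ).lt_iff_lt] at h
  exact lt_of_not_ge fun hle => h.not_ge (Real.sqrt_le_sqrt hle)

theorem neumannEigenvalue_zero_eq (hε : ε ∈ Ioo (0 : ℝ) 1) (hρ : 0 < layerDensity M ε) :
    neumannEigenvalue M ε 0 = 0 := by
  obtain ⟨h0, h⟩ := pruferPhase_sqrt_neumannEigenvalue hε hρ 0
  rw [Nat.cast_zero, zero_mul, ← pruferPhase_zero (M := M) (ε := ε),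
    (strictMono_pruferPhase hε hρ).injective.eq_iff] at h
  exact (Real.sqrt_eq_zero h0).1 h

end spectrum

/-! ### Regularity at `ε = 0` of the characteristic function -/

/-- Derivatives are one-sided here because `Real.sqrt` is zero on negative numbers, so `cos √y` and
`sinc √y` have a kink at `0`. -/
theorem hasDerivWithinAt_Ici_zero_of_abs_le_sq {f : ℝ → ℝ} {f' : ℝ}
    (h : ∀ y, 0 ≤ y → y ≤ 1 → |f y - f 0 - f' * y| ≤ y ^ 2) :
    HasDerivWithinAt f f' (Ici 0) 0 := by
  rw [hasDerivWithinAt_iff_isLittleO, isLittleO_iff]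
  intro c hc
  have h1 : ∀ᶠ y : ℝ in 𝓝[≥] 0, y < min c 1 :=
    nhdsWithin_le_nhds (Iio_mem_nhds (lt_min hc one_pos))
  filter_upwards [h1, self_mem_nhdsWithin] with y hy hy0
  have hy0 : 0 ≤ y := hy0
  have hyc := hy.trans_le (min_le_left _ _)
  simp only [sub_zero, smul_eq_mul, Real.norm_eq_abs, abs_of_nonneg hy0]
  rw [mul_comm y f']
  refine (h y hy0 (hy.trans_le (min_le_right _ _)).le).trans ?_
  rw [sq]
  gcongr

theorem hasDerivWithinAt_cos_sqrt_zero :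
    HasDerivWithinAt (fun y => Real.cos √y) (-1 / 2) (Ici 0) 0 := by
  refine hasDerivWithinAt_Ici_zero_of_abs_le_sq fun y hy hy1 => ?_
  have hx := Real.sq_sqrt hy
  have h := Real.cos_bound (x := √y) (by rwa [abs_of_nonneg (Real.sqrt_nonneg y), Real.sqrt_le_one])
  rw [show |√y| ^ 4 = (|√y| ^ 2) ^ 2 by ring, sq_abs, hx] at h
  rw [Real.sqrt_zero, Real.cos_zero, show Real.cos √y - 1 - -1 / 2 * y =
    Real.cos √y - (1 - y / 2) by ring]
  linarith [sq_nonneg y]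

theorem hasDerivWithinAt_sinc_sqrt_zero :
    HasDerivWithinAt (fun y => Real.sinc √y) (-1 / 6) (Ici 0) 0 := by
  refine hasDerivWithinAt_Ici_zero_of_abs_le_sq fun y hy hy1 => ?_
  rw [Real.sqrt_zero, Real.sinc_zero]
  rcases hy.eq_or_lt with rfl | hy0
  · simp
  have hx := Real.sq_sqrt hy
  have hx0 := Real.sqrt_pos.2 hy0
  have h := Real.sin_bound (x := √y) (by rwa [abs_of_pos hx0, Real.sqrt_le_one])
  rw [Real.sinc_of_ne_zero hx0.ne', show Real.sin √y / √y - 1 - -1 / 6 * y =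
    (Real.sin √y - (√y - √y ^ 3 / 6)) / √y by
      rw [show √y ^ 3 = √y ^ 2 * √y by ring, hx]; field_simp; ring, abs_div, abs_of_pos hx0,
    div_le_iff₀ hx0]
  refine h.trans ?_
  rw [abs_of_pos hx0, show √y ^ 5 = (√y ^ 2) ^ 2 * √y by ring, hx]
  nlinarith [mul_nonneg (sq_nonneg y) hx0.le]

/-- Positivity of `p 0` keeps `x * p x` in the half-line where `f` is controlled, for small `x ≥ 0`.
-/
theorem HasDerivWithinAt.comp_id_mul {f p : ℝ → ℝ} {f' : ℝ}
    (hf : HasDerivWithinAt f f' (Ici 0) 0) (hp : Differentiable ℝ p) (h0 : 0 < p 0) :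
    HasDerivWithinAt (fun x => f (x * p x)) (f' * p 0) (Ici 0) 0 := by
  have hs : {x | 0 < p x} ∩ Ici 0 ∈ 𝓝[≥] (0 : ℝ) :=
    inter_mem (nhdsWithin_le_nhds (hp.continuous.continuousAt.eventually_const_lt h0))
      self_mem_nhdsWithin
  have hd : HasDerivAt (fun x => x * p x) (p 0) 0 :=
    ((hasDerivAt_id (0 : ℝ)).mul (hp 0).hasDerivAt).congr_deriv (by simp)
  have := HasDerivWithinAt.comp_of_eq (s := {x | 0 < p x} ∩ Ici 0) 0 hf hd.hasDerivWithinAt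
    (fun x hx => mul_nonneg (show 0 ≤ x from hx.2) (le_of_lt hx.1)) (by simp)
  exact this.mono_of_mem_nhdsWithin hs

/-- The characteristic function of the odd Neumann eigenvalues, normalized to be regular at
`ε = 0`. -/
noncomputable def oddCharacteristic (M ε lam : ℝ) : ℝ :=
  Real.cos √(ε * (lam * (M / 2 - ε + ε ^ 2))) * Real.cos √(ε * (lam * (1 - ε) ^ 2)) -
    lam * (M / 2 - ε + ε ^ 2) * (1 - ε) * (Real.sinc √(ε * (lam * (M / 2 - ε + ε ^ 2))) *
      Real.sinc √(ε * (lam * (1 - ε) ^ 2)))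

theorem mul_sinc (x : ℝ) : x * Real.sinc x = Real.sin x := by
  rcases eq_or_ne x 0 with rfl | hx
  · simp
  · rw [Real.sinc_of_ne_zero hx]
    field_simp

theorem mul_layerDensity {M ε : ℝ} (hε : 0 < ε) :
    ε * layerDensity M ε = M / 2 - ε + ε ^ 2 := by
  unfold layerDensity
  field_simp

theorem sqrt_mul_sqrt_layerDensity_mul {M ε lam : ℝ} (hε : 0 < ε) (hρ : 0 < layerDensity M ε)
    (hlam : 0 ≤ lam) : √lam * √(layerDensity M ε) * ε = √(ε * (lam * (M / 2 - ε + ε ^ 2))) := by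
  rw [← mul_layerDensity hε, show ε * (lam * (ε * layerDensity M ε)) =
    lam * layerDensity M ε * ε ^ 2 by ring, Real.sqrt_mul (by positivity),
    Real.sqrt_mul hlam, Real.sqrt_sq hε.le]

theorem sqrt_mul_sqrt_mul_one_sub {ε lam : ℝ} (hε : ε ∈ Ioo (0 : ℝ) 1) (hlam : 0 ≤ lam) :
    √lam * √ε * (1 - ε) = √(ε * (lam * (1 - ε) ^ 2)) := by
  have := hε.1
  rw [show ε * (lam * (1 - ε) ^ 2) = lam * ε * (1 - ε) ^ 2 by ring,
    Real.sqrt_mul (by positivity), Real.sqrt_mul hlam, Real.sqrt_sq (sub_pos.2 hε.2).le]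

/-- Both sides are the value at the origin of the solution with data `(1, 0)` at `-1`. Writing `sin
x = x * sinc x` combines the unbounded ratio `r` with the two small angles into a factor that is
polynomial in `ε`. -/
theorem oddCharacteristic_eq {M ε lam : ℝ} (hε : ε ∈ Ioo (0 : ℝ) 1)
    (hρ : 0 < layerDensity M ε) (hlam : 0 ≤ lam) :
    ∃ Q, 0 < Q ∧ oddCharacteristic M ε lam = Q * Real.cos (pruferPhase M ε √lam) := by
  have hr : 0 < √(layerDensity M ε) / √ε := div_pos (Real.sqrt_pos.2 hρ) (Real.sqrt_pos.2 hε.1)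
  refine ⟨_, layerAmplitude_pos hr (√lam * √(layerDensity M ε) * ε), ?_⟩
  rw [pruferPhase, Real.cos_add, mul_sub, ← mul_assoc, ← mul_assoc, layerAmplitude_mul_cos hr,
    layerAmplitude_mul_sin hr, oddCharacteristic, ← sqrt_mul_sqrt_layerDensity_mul hε.1 hρ hlam,
    ← sqrt_mul_sqrt_mul_one_sub hε hlam, ← mul_layerDensity hε.1,
    ← mul_sinc (√lam * √(layerDensity M ε) * ε), ← mul_sinc (√lam * √ε * (1 - ε))]
  congr 1
  have h1 := Real.sq_sqrt hlam
  have h2 := Real.sq_sqrt hρ.le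
  have h3 := (Real.sqrt_pos.2 hε.1).ne'
  generalize Real.sinc (√lam * √(layerDensity M ε) * ε) = S
  generalize Real.sinc (√lam * √ε * (1 - ε)) = T
  calc _ = √lam ^ 2 * (ε * √(layerDensity M ε) ^ 2) * (1 - ε) * (S * T) := by rw [h1, h2]
    _ = _ := by field_simp

/-! ### Asymptotics as `ε → 0` -/

section asymptotics

variable {M : ℝ}

theorem eventually_layerDensity_pos (hM : 0 < M) :
    ∀ᶠ ε : ℝ in 𝓝[>] 0, ε ∈ Ioo (0 : ℝ) 1 ∧ 0 < layerDensity M ε := by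
  have h : ∀ᶠ ε : ℝ in 𝓝[>] 0, ε < min 1 (M / 2) :=
    nhdsWithin_le_nhds (Iio_mem_nhds (lt_min one_pos (half_pos hM)))
  filter_upwards [h, self_mem_nhdsWithin] with ε hε hε0
  have hε0 : 0 < ε := hε0
  have h2 := hε.trans_le (min_le_right _ _)
  refine ⟨⟨hε0, hε.trans_le (min_le_left _ _)⟩, ?_⟩
  have : 0 < ε * layerDensity M ε := by
    rw [mul_layerDensity hε0]
    nlinarith [sq_nonneg ε]
  exact (mul_pos_iff_of_pos_left hε0).1 this

/-- Both the layer angle and the inner angle tend to `0`. Once each is below `π / 2`, so is the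
layer phase, since it is increasing and fixes `π / 2`. -/
theorem eventually_pruferPhase_lt_pi (hM : 0 < M) {lam : ℝ} (hlam : 0 ≤ lam) :
    ∀ᶠ ε : ℝ in 𝓝[>] 0, pruferPhase M ε √lam < Real.pi := by
  have key : ∀ p : ℝ → ℝ, Continuous p → ∀ᶠ ε : ℝ in 𝓝[>] 0, √(ε * p ε) < Real.pi / 2 := by
    intro p hp
    have h : Continuous fun ε => √(ε * p ε) := by fun_prop
    refine nhdsWithin_le_nhds (h.continuousAt.eventually_lt_const ?_)
    simpa using Real.pi_pos
  filter_upwards [eventually_layerDensity_pos hM,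
    key (fun ε => lam * (M / 2 - ε + ε ^ 2)) (by fun_prop),
    key (fun ε => lam * (1 - ε) ^ 2) (by fun_prop)] with ε hε h1 h2
  obtain ⟨hε, hρ⟩ := hε
  have hr : 0 < √(layerDensity M ε) / √ε := div_pos (Real.sqrt_pos.2 hρ) (Real.sqrt_pos.2 hε.1)
  rw [← sqrt_mul_sqrt_layerDensity_mul hε.1 hρ hlam] at h1
  rw [← sqrt_mul_sqrt_mul_one_sub hε hlam] at h2
  have h3 := strictMono_layerPhase hr h1
  rw [layerPhase_pi_div_two] at h3
  unfold pruferPhase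
  linarith

/-- The higher eigenvalues diverge. -/
theorem tendsto_neumannEigenvalue_atTop (hM : 0 < M) {l : ℕ} (hl : 1 < l) :
    Tendsto (fun ε => neumannEigenvalue M ε l) (𝓝[>] 0) atTop := by
  refine tendsto_atTop.2 fun K => ?_
  filter_upwards [eventually_layerDensity_pos hM,
    eventually_pruferPhase_lt_pi hM (le_max_right K 0)] with ε hε h
  refine (le_max_left K 0).trans (lt_neumannEigenvalue_of_pruferPhase_lt hε.1 hε.2 ?_).le
  have : (2 : ℝ) ≤ l := by exact_mod_cast hl
  nlinarith [Real.pi_pos]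

/-- At `ε = 0` the squared angles divided by `ε` are `1` and `2 / M`. The cosines contribute `-(1 +
2 / M) / 2`, the `sinc` factors `(1 + 2 / M) / 6`, and the prefactor `1 + 2 / M - c * M / 2`. -/
theorem hasDerivWithinAt_oddCharacteristic (hM : 0 < M) (c : ℝ) :
    HasDerivWithinAt (fun ε => oddCharacteristic M ε (2 / M + c * ε))
      (M / 2 * (2 / 3 * (2 / M + (2 / M) ^ 2) - c)) (Ici 0) 0 := by
  have hY : Differentiable ℝ fun ε : ℝ => (2 / M + c * ε) * (M / 2 - ε + ε ^ 2) := by fun_prop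
  have hZ : Differentiable ℝ fun ε : ℝ => (2 / M + c * ε) * (1 - ε) ^ 2 := by fun_prop
  have hY0 : 0 < (2 / M + c * 0) * (M / 2 - 0 + 0 ^ 2) := by simp; positivity
  have hZ0 : 0 < (2 / M + c * 0) * (1 - 0 : ℝ) ^ 2 := by simp; positivity
  have hX : HasDerivAt
      (fun ε : ℝ => (2 / M + c * ε) * (M / 2 - ε + ε ^ 2) * (1 - ε))
      (c * (M / 2) - 2 / M - 1) 0 := by
    have h1 : HasDerivAt (fun ε : ℝ => 2 / M + c * ε) c 0 := by
      simpa using ((hasDerivAt_id (0 : ℝ)).const_mul c).const_add (2 / M)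
    have h2 : HasDerivAt (fun ε : ℝ => M / 2 - ε + ε ^ 2) (-1) 0 := by
      refine (((hasDerivAt_id (0 : ℝ)).const_sub (M / 2)).add (hasDerivAt_pow 2 0)).congr_deriv ?_
      simp
    have h3 : HasDerivAt (fun ε : ℝ => 1 - ε) (-1) 0 := by
      simpa using (hasDerivAt_id (0 : ℝ)).const_sub 1
    refine ((h1.mul h2).mul h3).congr_deriv ?_
    simp
    field_simp
    ring
  have hC := hasDerivWithinAt_cos_sqrt_zero
  have hS := hasDerivWithinAt_sinc_sqrt_zero
  refine (((hC.comp_id_mul hY hY0).mul (hC.comp_id_mul hZ hZ0)).sub (hX.hasDerivWithinAt.mul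
    ((hS.comp_id_mul hY hY0).mul (hS.comp_id_mul hZ hZ0)))).congr_deriv ?_
  simp
  field_simp
  ring

theorem eventually_oddCharacteristic_sign (hM : 0 < M) {c : ℝ} :
    (c < 2 / 3 * (2 / M + (2 / M) ^ 2) →
      ∀ᶠ ε : ℝ in 𝓝[>] 0, 0 < oddCharacteristic M ε (2 / M + c * ε)) ∧
    (2 / 3 * (2 / M + (2 / M) ^ 2) < c →
      ∀ᶠ ε : ℝ in 𝓝[>] 0, oddCharacteristic M ε (2 / M + c * ε) < 0) := by
  have h := hasDerivWithinAt_iff_tendsto_slope.1 (hasDerivWithinAt_oddCharacteristic hM c)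
  have h0 : oddCharacteristic M 0 (2 / M + c * 0) = 0 := by
    simp [oddCharacteristic]
    field_simp
    ring
  rw [Ici_sdiff_left] at h
  simp only [slope_fun_def, sub_zero, vsub_eq_sub, smul_eq_mul, h0] at h
  constructor <;> intro hc
  · filter_upwards [h.eventually_const_lt (mul_pos (half_pos hM) (sub_pos.2 hc)),
      self_mem_nhdsWithin] with ε h1 hε
    exact (mul_pos_iff_of_pos_left (inv_pos.2 hε)).1 h1
  · filter_upwards [h.eventually_lt_const (mul_neg_of_pos_of_neg (half_pos hM) (sub_neg.2 hc)),
      self_mem_nhdsWithin] with ε h1 hε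
    by_contra! h2
    exact h1.not_ge (mul_nonneg (inv_nonneg.2 (le_of_lt hε)) h2)

theorem eventually_mem_Icc_frequency (hM : 0 < M) (c : ℝ) :
    ∀ᶠ ε : ℝ in 𝓝[>] 0, 2 / M + c * ε ∈ Icc 0 (2 / M + 1) := by
  have h : Continuous fun ε : ℝ => 2 / M + c * ε := by fun_prop
  refine nhdsWithin_le_nhds (h.continuousAt.eventually_mem (Icc_mem_nhds ?_ ?_))
  · simpa using hM
  · simp

theorem eventually_lt_neumannEigenvalue_one (hM : 0 < M) {c : ℝ}
    (hc : c < 2 / 3 * (2 / M + (2 / M) ^ 2)) :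
    ∀ᶠ ε : ℝ in 𝓝[>] 0, 2 / M + c * ε < neumannEigenvalue M ε 1 := by
  filter_upwards [eventually_layerDensity_pos hM, (eventually_oddCharacteristic_sign hM).1 hc,
    eventually_mem_Icc_frequency hM c,
    eventually_pruferPhase_lt_pi hM (lam := 2 / M + 1) (by positivity)] with ε hε hpos hmem hpi
  refine lt_neumannEigenvalue_of_pruferPhase_lt hε.1 hε.2 ?_
  obtain ⟨Q, hQ, hQe⟩ := oddCharacteristic_eq hε.1 hε.2 hmem.1
  rw [hQe] at hpos
  have hcos := (mul_pos_iff_of_pos_left hQ).1 hpos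
  -- The bound by `π` holds for a fixed `lam`, so the moving value is compared with `2 / M + 1`.
  -- Below `π`, a positive cosine forces the phase below `π / 2`.
  have hle := (strictMono_pruferPhase hε.1 hε.2).monotone (Real.sqrt_le_sqrt hmem.2)
  by_contra! h
  refine hcos.not_ge (Real.cos_nonpos_of_pi_div_two_le_of_le ?_ ?_)
  · simpa using h
  · linarith [Real.pi_pos]

theorem eventually_neumannEigenvalue_one_lt (hM : 0 < M) {c : ℝ}
    (hc : 2 / 3 * (2 / M + (2 / M) ^ 2) < c) :
    ∀ᶠ ε : ℝ in 𝓝[>] 0, neumannEigenvalue M ε 1 < 2 / M + c * ε := by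
  filter_upwards [eventually_layerDensity_pos hM, (eventually_oddCharacteristic_sign hM).2 hc,
    eventually_mem_Icc_frequency hM c] with ε hε hneg hmem
  refine neumannEigenvalue_lt_of_lt_pruferPhase hε.1 hε.2 ?_
  obtain ⟨Q, hQ, hQe⟩ := oddCharacteristic_eq hε.1 hε.2 hmem.1
  rw [hQe] at hneg
  have h0 := (strictMono_pruferPhase hε.1 hε.2).monotone (Real.sqrt_nonneg (2 / M + c * ε))
  rw [pruferPhase_zero] at h0
  by_contra! h
  refine hneg.not_ge (mul_nonneg hQ.le (Real.cos_nonneg_of_neg_pi_div_two_le_of_le ?_ ?_))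
  · linarith [Real.pi_pos]
  · simpa using h

/-- First order expansion of the first nonzero Neumann eigenvalue. -/
theorem neumannEigenvalue_one_isLittleO (hM : 0 < M) :
    (fun ε : ℝ => neumannEigenvalue M ε 1 -
      (2 / M + 2 / 3 * (2 / M + (2 / M) ^ 2) * ε)) =o[𝓝[>] 0] (fun ε : ℝ => ε) := by
  rw [isLittleO_iff]
  intro δ hδ
  filter_upwards [eventually_lt_neumannEigenvalue_one hM (sub_lt_self _ hδ),
    eventually_neumannEigenvalue_one_lt hM (lt_add_of_pos_right _ hδ), self_mem_nhdsWithin]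
    with ε h1 h2 hε
  rw [Real.norm_eq_abs, Real.norm_eq_abs, abs_of_pos (show 0 < ε from hε), abs_le]
  constructor <;> linarith

end asymptotics

/-! ### The Steklov problem -/

theorem eq_left_of_hasDerivAt_zero {f : ℝ → ℝ} {a b : ℝ} (hf : ContinuousOn f (Icc a b))
    (hd : ∀ x ∈ Ioo a b, HasDerivAt f 0 x) : ∀ x ∈ Icc a b, f x = f a := by
  intro x hx
  rcases hx.1.eq_or_lt with rfl | h
  · rfl
  obtain ⟨c, -, hc⟩ := exists_hasDerivAt_eq_slope f (fun _ => 0) h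
    (hf.mono (Icc_subset_Icc_right hx.2)) fun y hy => hd y ⟨hy.1, hy.2.trans_le hx.2⟩
  have := (sub_pos.2 h).ne'
  field_simp at hc
  linarith

/-- Eigenfunctions are affine. Equating the two boundary slopes forces `u 1 = -u (-1)` when `lam ≠
0`, and comparing the end values then gives `lam * M = 2`. Conversely, the identity function is an
eigenfunction. -/
theorem steklovSpectrum_diff_zero {M : ℝ} (hM : 0 < M) : steklovSpectrum M \ {0} = {2 / M} := by
  ext lam
  rw [Set.mem_sdiff, mem_singleton_iff, mem_singleton_iff]
  constructor
  · rintro ⟨⟨u, hu⟩, hlam⟩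
    obtain ⟨h1, h2, h3⟩ := hu.contDiffOn.exists_deriv_Icc
    have hU : UniqueDiffOn ℝ (Icc (-1 : ℝ) 1) := uniqueDiffOn_Icc (by norm_num)
    have hl := hu.steklov_left.derivWithin (hU _ (by norm_num))
    have hr := hu.steklov_right.derivWithin (hU _ (by norm_num))
    have hd := eq_left_of_hasDerivAt_zero h1 fun x hx =>
      (hu.equation x hx).congr_of_eventuallyEq (h3 x hx)
    rw [hl] at hd
    have hlin := eq_left_of_hasDerivAt_zero (f := fun x => u x + lam * (M / 2) * u (-1) * x)
      (hu.contDiffOn.continuousOn.add (by fun_prop)) fun x hx => by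
        refine ((h2 x hx).add ((hasDerivAt_id x).const_mul _)).congr_deriv ?_
        rw [hd x (Ioo_subset_Icc_self hx)]
        ring
    have e1 := hd 1 (by norm_num)
    rw [hr] at e1
    have e2 := hlin 1 (by norm_num)
    have e3 : u 1 = -u (-1) := by
      have : lam * (M / 2) * (u 1 + u (-1)) = 0 := by linarith
      have := (mul_eq_zero.1 this).resolve_left (mul_ne_zero hlam (half_pos hM).ne')
      linarith
    have h0 : u (-1) ≠ 0 := by
      intro h0
      obtain ⟨x, hx, hux⟩ := hu.nontrivial
      have := hlin x hx
      simp only [h0] at this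
      exact hux (by linarith)
    have e4 : u (-1) * (lam * M - 2) = 0 := by
      rw [e3] at e2
      linarith
    have e5 := (mul_eq_zero.1 e4).resolve_left h0
    field_simp
    linarith
  · rintro rfl
    have h : 2 / M * (M / 2) = 1 := by field_simp
    refine ⟨⟨fun x => x, contDiff_id.contDiffOn, fun x _ => ?_, ?_, ?_, 1, by norm_num,
      one_ne_zero⟩, by positivity⟩
    · have : deriv (fun x : ℝ => x) = fun _ => 1 := funext fun x => deriv_id x
      rw [this]
      exact hasDerivAt_const x 1
    · exact (hasDerivWithinAt_id (-1 : ℝ) (Icc (-1) 1)).congr_deriv (by simp [h])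
    · exact (hasDerivWithinAt_id (1 : ℝ) (Icc (-1) 1)).congr_deriv (by simp [h])

theorem theorem2p11 (M : ℝ) (hM : 0 < M) :
    -- whenever the density is positive, the Neumann eigenvalues are simple and form the increasing
    -- sequence `neumannEigenvalue M ε`, which starts with `0`
    (∀ ε ∈ Ioo (0 : ℝ) 1, 0 < M / (2 * ε) - 1 + ε →
      StrictMono (neumannEigenvalue M ε) ∧
      range (neumannEigenvalue M ε) = neumannSpectrum M ε ∧
      neumannEigenvalue M ε 0 = 0 ∧
      ∀ (lam : ℝ) (u v : ℝ → ℝ), IsNeumannEigenfunction M ε lam u →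
        IsNeumannEigenfunction M ε lam v → ∃ c : ℝ, ∀ x ∈ Icc (-1 : ℝ) 1, v x = c * u x) ∧
    -- `2 / M` is the only nonzero Steklov eigenvalue
    steklovSpectrum M \ {0} = {2 / M} ∧
    -- first order asymptotics of the first nonzero eigenvalue
    (fun ε : ℝ => neumannEigenvalue M ε 1 -
        (2 / M + 2 / 3 * (2 / M + (2 / M) ^ 2) * ε)) =o[𝓝[>] 0] (fun ε : ℝ => ε) ∧
    -- divergence of the higher eigenvalues
    ∀ l : ℕ, 1 < l → Tendsto (fun ε : ℝ => neumannEigenvalue M ε l) (𝓝[>] 0) atTop :=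
  ⟨fun _ hε hρ => ⟨(strictMono_neumannEigenvalue hε hρ).1, (strictMono_neumannEigenvalue hε hρ).2,
      neumannEigenvalue_zero_eq hε hρ, fun _ _ _ hu hv => hu.exists_eq_mul hε hv⟩,
    steklovSpectrum_diff_zero hM, neumannEigenvalue_one_isLittleO hM,
    fun _ hl => tendsto_neumannEigenvalue_atTop hM hl⟩
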